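/- Call a sequence $w=w_1w_2\cdots w_k$ of $k$ distinct integers a permutation of length $k$. A descent of $w$ is an index $1\le i<k$ with $w_i>w_{i+1}$; let $\mathrm{des}(w)$ be the number of descents and $\mathrm{maj}(w)$ the sum of the descents of $w$. For integers $N\ge 0$ and $k$, let $$\begin{bmatrix}N\\k\end{bmatrix}=\frac{(1-q^N)(1-q^{N-1})\cdots(1-q^{N-k+1})}{(1-q^k)(1-q^{k-1})\cdots(1-q)}\quad(k\ge 0),\qquad \begin{bmatrix}N\\k\end{bmatrix}=0\quad(k<0).$$ Let $\delta=\delta_1\cdots\delta_m$ and $\pi=\pi_1\cdots\pi_n$ be permutations of lengths $m\ge 2$ and $n\ge 0$ without common letters, such that $\delta_1<\delta_2$ and every letter of $\delta$ is larger than every letter of $\pi$. Put $r=\mathrm{des}(\delta)$ and $s=\mathrm{des}(\pi)$, and assume that $n$ and $r$ are not both $0$. A shuffle of $\pi$ and $\delta$ is a permutation of length $m+n$ that contains both $\pi$ and $\delta$ as subsequences. Let $S_{l}$ be the set of shuffles $\alpha=\alpha_1\cdots\alpha_{m+n}$ of $\pi$ and $\delta$ with $\alpha_1=\delta_1$, let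 $S_{ls}$ be the set of those with $\alpha_1=\delta_1$ and $\alpha_{m+n}=\delta_m$, and let $S_{ll}$ be the set of those with $\alpha_1=\delta_1$ and $\alpha_2=\delta_2$. Then, for every integer $d\ge 0$, $$\sum_{\substack{\alpha\in S_{l}\\ \mathrm{des}(\alpha)=d}}q^{\mathrm{maj}(\alpha)}=\begin{bmatrix}m-r+s\\d-r\end{bmatrix}\begin{bmatrix}n-s+r-1\\d-s-1\end{bmatrix}q^{\mathrm{maj}(\delta)+\mathrm{maj}(\pi)+(d-s)(d-r)},$$ $$\sum_{\substack{\alpha\in S_{ls}\\ \mathrm{des}(\alpha)=d}}q^{\mathrm{maj}(\alpha)}=\begin{bmatrix}m-r+s-1\\d-r\end{bmatrix}\begin{bmatrix}n-s+r-1\\d-s-1\end{bmatrix}q^{\mathrm{maj}(\delta)+\mathrm{maj}(\pi)+(d-s)(d-r)},$$ $$\sum_{\substack{\alpha\in S_{ll}\\ \mathrm{des}(\alpha)=d}}q^{\mathrm{maj}(\alpha)}=\begin{bmatrix}m-r+s-1\\d-r\end{bmatrix}\begin{bmatrix}n-s+r-1\\d-s-1\end{bmatrix}q^{\mathrm{maj}(\delta)+\mathrm{maj}(\pi)+(d-s+1)(d-r)}.$$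 These are identities of rational functions in the indeterminate $q$. -/

import Mathlib

namespace ShuffleRefinement

/-- The `i`-th letter `w_i` of a word `w = w_1 w_2 ⋯ w_k` of integers, with the letters numbered
from `1`; it is only used for `1 ≤ i ≤ k`. -/
def letter (w : List ℤ) (i : ℕ) : ℤ := w.getD (i - 1) 0

/-- The descent set: all `i` with `1 ≤ i < k` and `w_i > w_{i+1}`, where `k` is the length. -/
def descentSet (w : List ℤ) : Finset ℕ :=
  (Finset.Ico 1 w.length).filter fun i => letter w (i + 1) < letter w i

/-- The number of descents. -/
def des (w : List ℤ) : ℕ := (descentSet w).card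

/-- The major index, the sum of the descents. -/
def maj (w : List ℤ) : ℕ := ∑ i ∈ descentSet w, i

/-- `IsPerm k w`: the word `w` is a sequence of `k` distinct integers. -/
def IsPerm (k : ℕ) (w : List ℤ) : Prop := w.Nodup ∧ w.length = k

/-- The finite set of shuffles of two disjoint permutations `p` and `d`: the arrangements of all
the letters of `p` and `d` that contain both `p` and `d` as subsequences. -/
def shuffles (p d : List ℤ) : Finset (List ℤ) :=
  (p ++ d).permutations.toFinset.filter fun a => p.Sublist a ∧ d.Sublist a

/-- For disjoint permutations of lengths `j` and `k`, the shuffles are exactly the permutations of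
length `j + k` that contain both as subsequences. -/
theorem mem_shuffles {j k : ℕ} {p d : List ℤ} (hp : IsPerm j p) (hd : IsPerm k d)
    (hpd : p.Disjoint d) (a : List ℤ) :
    a ∈ shuffles p d ↔ IsPerm (j + k) a ∧ p.Sublist a ∧ d.Sublist a := by
  have hnd : (p ++ d).Nodup := List.Nodup.append hp.1 hd.1 hpd
  have hlen : (p ++ d).length = j + k := by rw [List.length_append, hp.2, hd.2]
  simp only [shuffles, Finset.mem_filter, List.mem_toFinset, List.mem_permutations]
  constructor
  · rintro ⟨h, h1, h2⟩
    exact ⟨⟨h.nodup_iff.mpr hnd, h.length_eq.trans hlen⟩, h1, h2⟩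
  · rintro ⟨⟨_, ha'⟩, h1, h2⟩
    refine ⟨List.Perm.symm (List.Subperm.perm_of_length_le ?_ ?_), h1, h2⟩
    · refine List.subperm_of_subset hnd fun x hx => ?_
      rcases List.mem_append.mp hx with h | h
      · exact h1.subset h
      · exact h2.subset h
    · rw [ha', hlen]

/-- Shuffles `a` of `p` and `d` with `a_1 = d_1`. -/
def shufflesL (p d : List ℤ) : Finset (List ℤ) :=
  (shuffles p d).filter fun a => letter a 1 = letter d 1

/-- Shuffles `a` of `p` and `d` with `a_1 = d_1` whose last letter is the last letter of `d`. -/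
def shufflesLS (p d : List ℤ) : Finset (List ℤ) :=
  (shuffles p d).filter fun a =>
    letter a 1 = letter d 1 ∧ letter a a.length = letter d d.length

/-- Shuffles `a` of `p` and `d` with `a_1 = d_1` and `a_2 = d_2`. -/
def shufflesLL (p d : List ℤ) : Finset (List ℤ) :=
  (shuffles p d).filter fun a => letter a 1 = letter d 1 ∧ letter a 2 = letter d 2

noncomputable section

/-- The indeterminate `q`, in the field `ℚ(q)` of rational functions. -/
def q : RatFunc ℚ := RatFunc.X

/-- The Gaussian polynomial
`[N, k] = (1 - q^N)(1 - q^(N-1)) ⋯ (1 - q^(N-k+1)) / ((1 - q^k) ⋯ (1 - q))`, an element of `ℚ(q)`,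
with the usual convention that it vanishes for `k < 0`.
(For `0 ≤ N < k` it vanishes because `1 - q^0` is a factor of the numerator.) -/
def gauss (N k : ℤ) : RatFunc ℚ :=
  if k < 0 then 0
  else (∏ i ∈ Finset.range k.toNat, (1 - q ^ (N - (i : ℤ)))) /
    ∏ i ∈ Finset.range k.toNat, (1 - q ^ (i + 1))

/-- The generating function of the major index over the members of `A` with `d` descents. -/
def majGF (A : Finset (List ℤ)) (d : ℕ) : RatFunc ℚ :=
  ∑ a ∈ A.filter (fun a => des a = d), q ^ maj a

end

end ShuffleRefinement

/-! Shuffles starting with δ_1 are split by their last letter, δ_m (`shufflesLS`) or π_n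
(`shufflesLP`), and built by appending letters. Since every letter of δ exceeds every letter of π,
whether the appended letter makes a descent depends only on the class of the shorter word: from π to
δ never, from δ to π always, and within one word exactly when that word descends there. This gives
recursions for the two generating functions (`intMajGF_snocImage_shufflesL`). The closed forms
`formLS` and `formLP` satisfy the same recursions by the q-Pascal rule (`gauss_pascal`), and add up
to `formL`. An induction on δ, with one on π inside it, then gives the first two identities for
nonempty π; empty π is checked directly. For the third, deleting δ_1 < δ_2 shifts each of the d
descents by one and leaves the first identity for δ_2 ⋯ δ_m. -/

namespace ShuffleRefinement

/-! ### Gaussian coefficients -/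

theorem q_ne_zero : q ≠ 0 := RatFunc.X_ne_zero

theorem one_sub_q_pow_ne_zero (k : ℕ) : 1 - q ^ (k + 1) ≠ 0 := by
  intro h
  have h1 : (algebraMap (Polynomial ℚ) (RatFunc ℚ)) (1 - Polynomial.X ^ (k + 1)) = 0 := by
    simpa [q, RatFunc.algebraMap_X] using h
  have h2 : (1 - Polynomial.X ^ (k + 1) : Polynomial ℚ) = 0 :=
    (map_eq_zero_iff _ (RatFunc.algebraMap_injective ℚ)).mp h1
  have h3 := congrArg (Polynomial.eval 0) h2
  simp at h3

theorem gauss_of_neg (N : ℤ) {k : ℤ} (hk : k < 0) : gauss N k = 0 := if_pos hk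

theorem gauss_natCast (N : ℤ) (k : ℕ) :
    gauss N k = (∏ i ∈ Finset.range k, (1 - q ^ (N - (i : ℤ)))) /
      ∏ i ∈ Finset.range k, (1 - q ^ (i + 1)) := by
  simp [gauss]

theorem gauss_zero (N : ℤ) : gauss N 0 = 1 := by simp [gauss]

theorem gauss_eq_zero_of_lt {N k : ℤ} (hN : 0 ≤ N) (hk : N < k) : gauss N k = 0 := by
  lift k to ℕ using by omega
  lift N to ℕ using hN
  rw [gauss_natCast, Finset.prod_eq_zero (i := N) (by simpa using hk) (by simp), zero_div]

/-- For k > 0 this is 1 - q^N = (1 - q^(N-k)) + q^(N-k) (1 - q^k) times the common factors, so no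
sign condition on N is needed. -/
theorem gauss_pascal (N k : ℤ) :
    gauss N k = gauss (N - 1) k + q ^ (N - k) * gauss (N - 1) (k - 1) := by
  rcases lt_trichotomy k 0 with hk | rfl | hk
  · rw [gauss_of_neg _ hk, gauss_of_neg _ hk, gauss_of_neg _ (by omega)]; simp
  · rw [gauss_zero, gauss_zero, gauss_of_neg _ (by omega)]; simp
  · obtain ⟨K, rfl⟩ : ∃ K : ℕ, k = ((K + 1 : ℕ) : ℤ) := ⟨(k - 1).toNat, by omega⟩
    have e : ((K + 1 : ℕ) : ℤ) - 1 = (K : ℤ) := by push_cast; ring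
    rw [e, gauss_natCast, gauss_natCast, gauss_natCast, Finset.prod_range_succ',
      Finset.prod_range_succ (fun i : ℕ => 1 - q ^ (N - 1 - (i : ℤ))),
      Finset.prod_range_succ (fun i : ℕ => 1 - q ^ (i + 1))]
    have e2 : ∏ i ∈ Finset.range K, (1 - q ^ (N - ((i + 1 : ℕ) : ℤ))) =
        ∏ i ∈ Finset.range K, (1 - q ^ (N - 1 - (i : ℤ))) :=
      Finset.prod_congr rfl fun i _ => by congr 2; push_cast; ring
    have hD : ∏ i ∈ Finset.range K, (1 - q ^ (i + 1)) ≠ 0 :=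
      Finset.prod_ne_zero_iff.mpr fun i _ => one_sub_q_pow_ne_zero i
    have hK := one_sub_q_pow_ne_zero K
    have e3 : q ^ (N - ((0 : ℕ) : ℤ)) = q ^ (N - 1 - (K : ℤ)) * q ^ (K + 1) := by
      rw [← zpow_natCast, ← zpow_add₀ q_ne_zero]; congr 1; push_cast; ring
    have e4 : N - ((K + 1 : ℕ) : ℤ) = N - 1 - (K : ℤ) := by push_cast; ring
    rw [e2, e3, e4]
    field_simp
    ring

theorem gauss_self {N : ℤ} (hN : 0 ≤ N) : gauss N N = 1 := by
  lift N to ℕ using hN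
  induction N with
  | zero => exact gauss_zero _
  | succ n ih =>
    rw [gauss_pascal, gauss_eq_zero_of_lt (by push_cast; omega) (by omega)]
    simpa using ih

/-! ### Descents and major index -/

theorem letter_append_of_le {w v : List ℤ} {i : ℕ} (h0 : w ≠ []) (hi : i ≤ w.length) :
    letter (w ++ v) i = letter w i := by
  have := List.length_pos_iff.mpr h0
  exact List.getD_append _ _ _ _ (by omega)

theorem letter_snoc_length (w : List ℤ) (u : ℤ) : letter (w ++ [u]) (w.length + 1) = u := by
  simp [letter]

theorem letter_cons_succ (x : ℤ) (w : List ℤ) {i : ℕ} (hi : 1 ≤ i) :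
    letter (x :: w) (i + 1) = letter w i := by
  obtain ⟨j, rfl⟩ := Nat.exists_eq_add_of_le' hi
  simp [letter]

theorem descentSet_snoc (w : List ℤ) (u v : ℤ) :
    descentSet (w ++ [u] ++ [v]) =
      if v < u then insert (w.length + 1) (descentSet (w ++ [u])) else descentSet (w ++ [u]) := by
  have hA : ∀ i, i ≤ w.length + 1 → letter (w ++ [u] ++ [v]) i = letter (w ++ [u]) i :=
    fun i hi => letter_append_of_le (by simp) (by simpa using hi)
  have hu : letter (w ++ [u]) (w.length + 1) = u := letter_snoc_length w u
  have hv : letter (w ++ [u] ++ [v]) (w.length + 1 + 1) = v := by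
    simpa using letter_snoc_length (w ++ [u]) v
  ext i
  rcases lt_trichotomy i (w.length + 1) with hi | rfl | hi
  · have h : i ∈ descentSet (w ++ [u] ++ [v]) ↔ i ∈ descentSet (w ++ [u]) := by
      simp only [descentSet, Finset.mem_filter, Finset.mem_Ico, hA i hi.le, hA (i + 1) hi,
        List.length_append, List.length_singleton]
      constructor <;> rintro ⟨h, h'⟩ <;> exact ⟨by omega, h'⟩
    split_ifs <;> simp [hi.ne, -List.append_assoc, h]
  · simp only [descentSet, Finset.mem_filter, Finset.mem_Ico, hA _ le_rfl, hu, hv]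
    split_ifs with h <;> simp [h]
  · have h : i ∉ descentSet (w ++ [u]) := by
      simp [descentSet]; omega
    have h' : i ∉ descentSet (w ++ [u] ++ [v]) := by
      simp [descentSet]; omega
    split_ifs <;> simp [h, hi.ne', -List.append_assoc, h']

theorem succ_length_notMem_descentSet (w : List ℤ) (u : ℤ) :
    w.length + 1 ∉ descentSet (w ++ [u]) := by simp [descentSet]

theorem des_snoc (w : List ℤ) (u v : ℤ) :
    des (w ++ [u] ++ [v]) = des (w ++ [u]) + if v < u then 1 else 0 := by
  rw [des, descentSet_snoc]
  split_ifs
  · rw [Finset.card_insert_of_notMem (succ_length_notMem_descentSet w u)]; rfl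
  · rfl

theorem maj_snoc (w : List ℤ) (u v : ℤ) :
    maj (w ++ [u] ++ [v]) = maj (w ++ [u]) + if v < u then w.length + 1 else 0 := by
  rw [maj, descentSet_snoc]
  split_ifs
  · rw [Finset.sum_insert (succ_length_notMem_descentSet w u), add_comm]; rfl
  · rfl

/-- For `w = []` the hypothesis compares `x` with the default letter 0, which is harmless: both
descent sets are empty. -/
theorem descentSet_cons_of_ascent {x : ℤ} {w : List ℤ} (h : x < letter w 1) :
    descentSet (x :: w) = (descentSet w).map (addRightEmbedding 1) := by
  ext i
  simp only [descentSet, Finset.mem_map, Finset.mem_filter, Finset.mem_Ico,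
    addRightEmbedding_apply, List.length_cons]
  constructor
  · rintro ⟨h1, h2⟩
    have hi : i ≠ 1 := by
      rintro rfl
      rw [letter_cons_succ _ _ le_rfl] at h2
      exact absurd h2 (not_lt.mpr h.le)
    obtain ⟨j, rfl⟩ := Nat.exists_eq_add_of_le' h1.1
    have hj : 1 ≤ j := by omega
    rw [letter_cons_succ _ _ hj, letter_cons_succ _ _ (by omega)] at h2
    exact ⟨j, ⟨by omega, h2⟩, rfl⟩
  · rintro ⟨j, ⟨h1, h2⟩, rfl⟩
    rw [letter_cons_succ _ _ h1.1, letter_cons_succ _ _ (by omega)]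
    exact ⟨by omega, h2⟩

theorem des_cons_of_ascent {x : ℤ} {w : List ℤ} (h : x < letter w 1) :
    des (x :: w) = des w := by
  rw [des, descentSet_cons_of_ascent h, Finset.card_map]; rfl

theorem maj_cons_of_ascent {x : ℤ} {w : List ℤ} (h : x < letter w 1) :
    maj (x :: w) = maj w + des w := by
  rw [maj, descentSet_cons_of_ascent h, Finset.sum_map]
  simp [Finset.sum_add_distrib, maj, des]

theorem des_singleton (x : ℤ) : des [x] = 0 := by simp [des, descentSet]

theorem maj_singleton (x : ℤ) : maj [x] = 0 := by simp [maj, descentSet]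

/-! ### Generating functions -/

/-- The generating function of the major index over the members of `A` with `k` descents, graded
by an integer `k`. -/
noncomputable def intMajGF (A : Finset (List ℤ)) (k : ℤ) : RatFunc ℚ :=
  ∑ a ∈ A, if (des a : ℤ) = k then q ^ maj a else 0

theorem majGF_eq_intMajGF (A : Finset (List ℤ)) (d : ℕ) : majGF A d = intMajGF A d := by
  simp [majGF, intMajGF, Finset.sum_filter]

theorem intMajGF_union {A B : Finset (List ℤ)} (h : Disjoint A B) (k : ℤ) :
    intMajGF (A ∪ B) k = intMajGF A k + intMajGF B k := Finset.sum_union h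

theorem intMajGF_singleton (w : List ℤ) (k : ℤ) :
    intMajGF {w} k = if (des w : ℤ) = k then q ^ maj w else 0 := by simp [intMajGF]

/-- Append the letter `v` to every word of `A`. -/
def snocImage (A : Finset (List ℤ)) (v : ℤ) : Finset (List ℤ) := A.image (· ++ [v])

/-- All words of `A` share their length and last letter, so `v` creates a descent at position `n` in
all of them or in none. -/
theorem intMajGF_snocImage {A : Finset (List ℤ)} {u v : ℤ} {n : ℕ}
    (hA : ∀ a ∈ A, a.length = n ∧ ∃ w, a = w ++ [u]) (k : ℤ) :
    intMajGF (snocImage A v) k =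
      if v < u then q ^ n * intMajGF A (k - 1) else intMajGF A k := by
  rw [intMajGF, snocImage, Finset.sum_image fun a _ b _ h => List.append_cancel_right h]
  split_ifs with huv
  · rw [intMajGF, Finset.mul_sum]
    refine Finset.sum_congr rfl fun a ha => ?_
    obtain ⟨hl, w, rfl⟩ := hA a ha
    have hl' : w.length + 1 = n := by simpa using hl
    rw [des_snoc, maj_snoc, if_pos huv, if_pos huv, hl', pow_add]
    push_cast
    simp only [eq_sub_iff_add_eq, mul_ite, mul_zero, mul_comm]
  · refine Finset.sum_congr rfl fun a ha => ?_
    obtain ⟨-, w, rfl⟩ := hA a ha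
    rw [des_snoc, maj_snoc, if_neg huv, if_neg huv, add_zero, add_zero]

/-! ### Shuffles by last letter -/

/-- Shuffles `a` of `p` and `d` with `a_1 = d_1` whose last letter is the last letter of `p`. -/
def shufflesLP (p d : List ℤ) : Finset (List ℤ) :=
  (shuffles p d).filter fun a =>
    letter a 1 = letter d 1 ∧ letter a a.length = letter p p.length

theorem mem_shuffles_iff {p d a : List ℤ} :
    a ∈ shuffles p d ↔ a.Perm (p ++ d) ∧ p.Sublist a ∧ d.Sublist a := by
  simp [shuffles, List.mem_permutations]

theorem sublist_snoc_of_notMem {p a : List ℤ} {v : ℤ} (hv : v ∉ p) (h : p.Sublist (a ++ [v])) :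
    p.Sublist a := by
  obtain ⟨l₁, l₂, rfl, h1, h2⟩ := List.sublist_append_iff.mp h
  rcases l₂ with _ | ⟨x, t⟩
  · simpa using h1
  · have := h2.subset List.mem_cons_self
    simp at this hv
    exact absurd this.symm hv.2.1

theorem snoc_mem_shuffles_right {p d a : List ℤ} {y : ℤ} (hy : y ∉ p) :
    a ++ [y] ∈ shuffles p (d ++ [y]) ↔ a ∈ shuffles p d := by
  rw [mem_shuffles_iff, mem_shuffles_iff, ← List.append_assoc, List.perm_append_right_iff]
  refine and_congr_right fun _ => and_congr ⟨sublist_snoc_of_notMem hy, fun h => ?_⟩ ?_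
  · exact h.trans (List.sublist_append_left _ _)
  · exact List.append_sublist_append_right _

theorem shuffles_comm (p d : List ℤ) : shuffles p d = shuffles d p := by
  ext a
  rw [mem_shuffles_iff, mem_shuffles_iff, and_comm (a := p.Sublist a)]
  exact and_congr_left' ⟨fun h => h.trans List.perm_append_comm,
    fun h => h.trans List.perm_append_comm⟩

theorem snoc_mem_shuffles_left {p d a : List ℤ} {x : ℤ} (hx : x ∉ d) :
    a ++ [x] ∈ shuffles (p ++ [x]) d ↔ a ∈ shuffles p d := by
  rw [shuffles_comm, snoc_mem_shuffles_right hx, shuffles_comm]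

theorem length_of_mem_shuffles {p d a : List ℤ} (h : a ∈ shuffles p d) :
    a.length = p.length + d.length := by
  simpa using (mem_shuffles_iff.mp h).1.length_eq

theorem ne_nil_of_mem_shuffles {p d a : List ℤ} (hd : d ≠ []) (h : a ∈ shuffles p d) : a ≠ [] := by
  have := length_of_mem_shuffles h
  have := List.length_pos_iff.mpr hd
  exact List.length_pos_iff.mp (by omega)

theorem letter_length_snoc (w : List ℤ) (u : ℤ) :
    letter (w ++ [u]) (w ++ [u]).length = u := by simpa using letter_snoc_length w u

theorem exists_snoc_of_letter {a : List ℤ} (h : a ≠ []) {u : ℤ} (hu : letter a a.length = u) :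
    ∃ w, a = w ++ [u] := by
  rcases List.eq_nil_or_concat' a with rfl | ⟨w, x, rfl⟩
  · exact absurd rfl h
  · rw [letter_length_snoc] at hu
    exact ⟨w, by rw [hu]⟩

theorem one_le_length {w : List ℤ} (h : w ≠ []) : 1 ≤ w.length := List.length_pos_iff.mpr h

theorem shufflesLS_snoc {p d : List ℤ} {y : ℤ} (hd : d ≠ []) (hy : y ∉ p) :
    shufflesLS p (d ++ [y]) = snocImage (shufflesL p d) y := by
  ext a
  simp only [shufflesLS, shufflesL, snocImage, Finset.mem_filter, Finset.mem_image,
    letter_length_snoc, letter_append_of_le hd (one_le_length hd)]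
  constructor
  · rintro ⟨ha, h1, h2⟩
    obtain ⟨w, rfl⟩ := exists_snoc_of_letter (ne_nil_of_mem_shuffles (by simp) ha) h2
    have hw := (snoc_mem_shuffles_right hy).mp ha
    have hn := ne_nil_of_mem_shuffles hd hw
    rw [letter_append_of_le hn (one_le_length hn)] at h1
    exact ⟨w, ⟨hw, h1⟩, rfl⟩
  · rintro ⟨w, ⟨hw, h1⟩, rfl⟩
    have hn := ne_nil_of_mem_shuffles hd hw
    exact ⟨(snoc_mem_shuffles_right hy).mpr hw,
      by rwa [letter_append_of_le hn (one_le_length hn)], letter_length_snoc _ _⟩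

theorem shufflesLP_snoc {p d : List ℤ} {x : ℤ} (hd : d ≠ []) (hx : x ∉ d) :
    shufflesLP (p ++ [x]) d = snocImage (shufflesL p d) x := by
  ext a
  simp only [shufflesLP, shufflesL, snocImage, Finset.mem_filter, Finset.mem_image,
    letter_length_snoc]
  constructor
  · rintro ⟨ha, h1, h2⟩
    obtain ⟨w, rfl⟩ := exists_snoc_of_letter (ne_nil_of_mem_shuffles hd ha) h2
    have hw := (snoc_mem_shuffles_left hx).mp ha
    have hn := ne_nil_of_mem_shuffles hd hw
    rw [letter_append_of_le hn (one_le_length hn)] at h1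
    exact ⟨w, ⟨hw, h1⟩, rfl⟩
  · rintro ⟨w, ⟨hw, h1⟩, rfl⟩
    have hn := ne_nil_of_mem_shuffles hd hw
    exact ⟨(snoc_mem_shuffles_left hx).mpr hw,
      by rwa [letter_append_of_le hn (one_le_length hn)], letter_length_snoc _ _⟩

theorem shufflesL_nil {d : List ℤ} : shufflesL [] d = {d} := by
  ext a
  simp only [shufflesL, Finset.mem_filter, mem_shuffles_iff, Finset.mem_singleton, List.nil_append]
  constructor
  · rintro ⟨⟨h1, -, h2⟩, -⟩
    exact (h2.eq_of_length h1.length_eq.symm).symm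
  · rintro rfl
    simp

theorem shufflesLS_nil {d : List ℤ} : shufflesLS [] d = {d} := by
  ext a
  simp only [shufflesLS, Finset.mem_filter, mem_shuffles_iff, Finset.mem_singleton, List.nil_append]
  constructor
  · rintro ⟨⟨h1, -, h2⟩, -⟩
    exact (h2.eq_of_length h1.length_eq.symm).symm
  · rintro rfl
    simp

theorem snoc_sublist_of_ne {p w : List ℤ} {x z : ℤ} (hxz : x ≠ z)
    (h : (p ++ [x]).Sublist (w ++ [z])) : (p ++ [x]).Sublist w := by
  -- Reversal moves the last letters to the front, where the sublist relation can be inverted.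
  rw [← List.reverse_sublist] at h ⊢
  simp only [List.reverse_append, List.reverse_singleton, List.singleton_append] at h ⊢
  cases h with
  | cons _ h => exact h
  | cons_cons _ h => exact absurd rfl hxz

/-- If the last letter `z` ended neither word, both would already embed in the rest of `a`; then
`z`, a letter of one of them, would occur twice in `a`. -/
theorem letter_length_of_mem_shuffles {p d a : List ℤ} (hp : p ≠ []) (hd : d ≠ [])
    (hnd : (p ++ d).Nodup) (ha : a ∈ shuffles p d) :
    letter a a.length = letter d d.length ∨ letter a a.length = letter p p.length := by
  obtain ⟨hperm, hpa, hda⟩ := mem_shuffles_iff.mp ha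
  rcases List.eq_nil_or_concat' a with rfl | ⟨w, z, rfl⟩
  · exact absurd rfl (ne_nil_of_mem_shuffles hd ha)
  rcases List.eq_nil_or_concat' p with rfl | ⟨p, x, rfl⟩
  · exact absurd rfl hp
  rcases List.eq_nil_or_concat' d with rfl | ⟨d, y, rfl⟩
  · exact absurd rfl hd
  simp only [letter_length_snoc]
  by_contra! hne
  have hzw : z ∉ w := by
    have h := hperm.nodup_iff.mpr hnd
    simp only [List.nodup_append, List.mem_singleton] at h
    exact fun hz => h.2.2 z hz z rfl rfl
  rcases List.mem_append.mp (hperm.subset (show z ∈ w ++ [z] by simp)) with hz | hz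
  · exact hzw ((snoc_sublist_of_ne hne.2.symm hpa).subset hz)
  · exact hzw ((snoc_sublist_of_ne hne.1.symm hda).subset hz)

theorem shufflesL_eq_union {p d : List ℤ} (hp : p ≠ []) (hd : d ≠ []) (hnd : (p ++ d).Nodup) :
    shufflesL p d = shufflesLS p d ∪ shufflesLP p d := by
  ext a
  simp only [shufflesL, shufflesLS, shufflesLP, Finset.mem_union, Finset.mem_filter]
  have := @letter_length_of_mem_shuffles p d a hp hd hnd
  tauto

theorem disjoint_shufflesLS_shufflesLP {p d : List ℤ} (h : letter p p.length ≠ letter d d.length) :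
    Disjoint (shufflesLS p d) (shufflesLP p d) := by
  rw [Finset.disjoint_left]
  intro a h1 h2
  simp only [shufflesLS, shufflesLP, Finset.mem_filter] at h1 h2
  exact h (h2.2.2.symm.trans h1.2.2)

theorem snocImage_union (A B : Finset (List ℤ)) (v : ℤ) :
    snocImage (A ∪ B) v = snocImage A v ∪ snocImage B v := Finset.image_union _ _

/-- The single letter `y` would be both first and last in a word of length at least 2. -/
theorem shufflesLS_singleton {p : List ℤ} {y : ℤ} (hp : p ≠ []) (hnd : (p ++ [y]).Nodup) :
    shufflesLS p [y] = ∅ := by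
  refine Finset.eq_empty_of_forall_notMem fun a ha => ?_
  simp only [shufflesLS, Finset.mem_filter] at ha
  obtain ⟨ha, h1, h2⟩ := ha
  have hn := ne_nil_of_mem_shuffles (by simp) ha
  have hl := length_of_mem_shuffles ha
  obtain ⟨w, rfl⟩ := exists_snoc_of_letter hn h2
  have hw := one_le_length hp
  have hw' : w ≠ [] := by
    rintro rfl
    simp only [List.length_append, List.length_nil, List.length_singleton] at hl
    omega
  rw [letter_append_of_le hw' (one_le_length hw')] at h1
  have hnd' := (mem_shuffles_iff.mp ha).1.nodup_iff.mpr hnd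
  obtain ⟨z, t, rfl⟩ := List.exists_cons_of_ne_nil hw'
  simp [letter] at h1 hnd'
  tauto

/-- Words of `shufflesLS p d` have constant length and last letter. -/
theorem shufflesLS_shape {p d : List ℤ} (hd : d ≠ []) :
    ∀ a ∈ shufflesLS p d, a.length = p.length + d.length ∧
      ∃ w, a = w ++ [letter d d.length] := by
  intro a ha
  simp only [shufflesLS, Finset.mem_filter] at ha
  exact ⟨length_of_mem_shuffles ha.1,
    exists_snoc_of_letter (ne_nil_of_mem_shuffles hd ha.1) ha.2.2⟩

/-- Words of `shufflesLP p d` have constant length and last letter. -/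
theorem shufflesLP_shape {p d : List ℤ} (hd : d ≠ []) :
    ∀ a ∈ shufflesLP p d, a.length = p.length + d.length ∧
      ∃ w, a = w ++ [letter p p.length] := by
  intro a ha
  simp only [shufflesLP, Finset.mem_filter] at ha
  exact ⟨length_of_mem_shuffles ha.1,
    exists_snoc_of_letter (ne_nil_of_mem_shuffles hd ha.1) ha.2.2⟩


/-! ### Closed forms -/

/-- Closed form for the shuffles that start with `δ_1` and end with `δ_m`, where
`M = maj δ + maj π`. -/
noncomputable def formLS (m r n s M k : ℤ) : RatFunc ℚ :=
  gauss (m - r + s - 1) (k - r) * gauss (n - s + r - 1) (k - s - 1) *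
    q ^ (M + (k - s) * (k - r))

/-- Closed form for the shuffles that start with `δ_1` and end with `π_n`. -/
noncomputable def formLP (m r n s M k : ℤ) : RatFunc ℚ :=
  gauss (m - r + s - 1) (k - r - 1) * gauss (n - s + r - 1) (k - s - 1) *
    q ^ (M + (k - s) * (k - r) + (m + s - k))

/-- Closed form for the shuffles that start with `δ_1`. -/
noncomputable def formL (m r n s M k : ℤ) : RatFunc ℚ :=
  gauss (m - r + s) (k - r) * gauss (n - s + r - 1) (k - s - 1) *
    q ^ (M + (k - s) * (k - r))

/-- This is q-Pascal on the first Gaussian factor; the extra exponent m + s - k in `formLP` is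
exactly the Pascal exponent. -/
theorem formLS_add_formLP (m r n s M k : ℤ) :
    formLS m r n s M k + formLP m r n s M k = formL m r n s M k := by
  rw [formLS, formLP, formL, gauss_pascal (m - r + s), zpow_add₀ q_ne_zero _ (m + s - k),
    show m - r + s - (k - r) = m + s - k by ring]
  ring

theorem formLS_ascent (m r n s M k : ℤ) : formLS (m + 1) r n s M k = formL m r n s M k := by
  rw [formLS, formL, show m + 1 - r + s - 1 = m - r + s by ring]

theorem q_zpow_mul_q_zpow_sub (a b c : ℤ) : q ^ c * q ^ (a + b - c) = q ^ a * q ^ b := by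
  rw [← zpow_add₀ q_ne_zero, ← zpow_add₀ q_ne_zero, add_sub_cancel]

/-- The recursion for appending to δ a letter below δ_m: maj δ grows by m, and only shuffles ending
in δ_m gain a descent, at position m + n. It is q-Pascal on the second Gaussian factor. -/
theorem formLS_descent (m r n s M k : ℤ) :
    formLS (m + 1) (r + 1) n s (M + m) k =
      q ^ (m + n) * formLS m r n s M (k - 1) + formLP m r n s M k := by
  rw [formLS, formLS, formLP, show m + 1 - (r + 1) + s - 1 = m - r + s - 1 by ring,
    show n - s + (r + 1) - 1 = n - s + r by ring, gauss_pascal (n - s + r),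
    show k - (r + 1) = k - 1 - r by ring, show k - 1 - s - 1 = k - s - 1 - 1 by ring,
    show k - r - 1 = k - 1 - r by ring,
    show M + (k - s) * (k - r) + (m + s - k) = M + m + (k - s) * (k - 1 - r) by ring,
    -- Written as a + b - c with c the Pascal exponent, so that the Pascal power of q cancels.
    show M + m + (k - s) * (k - 1 - r) =
      (m + n) + (M + (k - 1 - s) * (k - 1 - r)) - (n - s + r - (k - s - 1)) by ring]
  linear_combination gauss (m - r + s - 1) (k - 1 - r) *
    gauss (n - s + r - 1) (k - s - 1 - 1) * q_zpow_mul_q_zpow_sub (m + n)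
      (M + (k - 1 - s) * (k - 1 - r)) (n - s + r - (k - s - 1))

theorem formLP_ascent (m r n s M k : ℤ) :
    formLP m r (n + 1) s M k =
      q ^ (m + n) * formLS m r n s M (k - 1) + formLP m r n s M k := by
  rw [formLP, formLS, formLP, show n + 1 - s + r - 1 = n - s + r by ring, gauss_pascal (n - s + r),
    show k - 1 - s - 1 = k - s - 1 - 1 by ring, show k - 1 - r = k - r - 1 by ring,
    show M + (k - s) * (k - r) + (m + s - k) =
      (m + n) + (M + (k - 1 - s) * (k - r - 1)) - (n - s + r - (k - s - 1)) by ring]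
  linear_combination gauss (m - r + s - 1) (k - r - 1) *
    gauss (n - s + r - 1) (k - s - 1 - 1) * q_zpow_mul_q_zpow_sub (m + n)
      (M + (k - 1 - s) * (k - r - 1)) (n - s + r - (k - s - 1))

/-- A letter below π_n makes a descent after either class, so the whole of `formL` is shifted and no
Pascal step is needed. -/
theorem formLP_descent (m r n s M k : ℤ) :
    formLP m r (n + 1) (s + 1) (M + n) k = q ^ (m + n) * formL m r n s M (k - 1) := by
  rw [formLP, formL, mul_left_comm, ← zpow_add₀ q_ne_zero]
  congr 1
  · congr 2 <;> ring
  · congr 1; ring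

theorem formLS_one {n s M k : ℤ} (hs : 0 ≤ s) : formLS 1 0 n s M k = 0 := by
  rw [formLS]
  rcases lt_or_ge k (s + 1) with h | h
  · rw [gauss_of_neg (n - s + 0 - 1) (by omega)]; simp
  · rw [gauss_eq_zero_of_lt (by omega) (by omega)]; simp

/-- The only word is δ followed by π_1. The first Gaussian factor forces k ≥ r + 1 and the second k
≤ r + 1. -/
theorem formLP_one {m r M k : ℤ} (hr : 0 ≤ r) :
    formLP m r 1 0 M k = if k = r + 1 then q ^ (m + M) else 0 := by
  rw [formLP]
  split_ifs with h
  · subst h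
    rw [show r + 1 - r - 1 = 0 by ring, gauss_zero, show 1 - 0 + r - 1 = r by ring,
      show r + 1 - 0 - 1 = r by ring, gauss_self hr, one_mul, one_mul]
    congr 1; ring
  · rcases lt_or_gt_of_ne h with h | h
    · rw [gauss_of_neg _ (by omega)]; simp
    · rw [gauss_eq_zero_of_lt (N := 1 - 0 + r - 1) (by omega) (by omega)]; simp

/-- For r = 0 the second factor at k = 0 would have lower entry -1 and vanish, although δ itself
contributes 1; hence n = r = 0 is excluded. -/
theorem formLS_zero {m r M k : ℤ} (hr : 1 ≤ r) :
    formLS m r 0 0 M k = if k = r then q ^ M else 0 := by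
  rw [formLS]
  split_ifs with h
  · subst h
    rw [show k - k = 0 by ring, gauss_zero, show 0 - 0 + k - 1 = k - 1 by ring,
      show k - 0 - 1 = k - 1 by ring, gauss_self (by omega), one_mul, one_mul]
    congr 1; ring
  · rcases lt_or_gt_of_ne h with h | h
    · rw [gauss_of_neg _ (by omega)]; simp
    · rw [gauss_eq_zero_of_lt (N := 0 - 0 + r - 1) (by omega) (by omega)]; simp

/-! ### The generating functions -/

/-- The hypotheses on the two words: no repeated letter, and the letters of `d` exceed those
of `p`. -/
def Separated (p d : List ℤ) : Prop := (p ++ d).Nodup ∧ ∀ x ∈ d, ∀ y ∈ p, y < x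

theorem Separated.of_snoc_right {p d : List ℤ} {y : ℤ} (h : Separated p (d ++ [y])) :
    Separated p d := by
  refine ⟨?_, fun x hx => h.2 x (by simp [hx])⟩
  have := h.1
  rw [← List.append_assoc] at this
  exact this.sublist (List.sublist_append_left _ _)

theorem Separated.of_snoc_left {p d : List ℤ} {x : ℤ} (h : Separated (p ++ [x]) d) :
    Separated p d := by
  refine ⟨h.1.sublist ?_, fun z hz y hy => h.2 z hz y (by simp [hy])⟩
  exact (List.sublist_append_left _ _).append (List.Sublist.refl _)

theorem Separated.notMem_right {p d : List ℤ} {y : ℤ} (h : Separated p d) (hy : y ∈ d) : y ∉ p :=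
  fun hp => lt_irrefl y (h.2 y hy y hp)

theorem letter_length_mem {w : List ℤ} (h : w ≠ []) : letter w w.length ∈ w := by
  rcases List.eq_nil_or_concat' w with rfl | ⟨w, x, rfl⟩
  · exact absurd rfl h
  · rw [letter_length_snoc]; simp

theorem Separated.letter_lt {p d : List ℤ} (h : Separated p d) (hp : p ≠ []) (hd : d ≠ []) :
    letter p p.length < letter d d.length :=
  h.2 _ (letter_length_mem hd) _ (letter_length_mem hp)

theorem intMajGF_shufflesL {p d : List ℤ} (h : Separated p d) (hp : p ≠ []) (hd : d ≠ []) (k : ℤ) :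
    intMajGF (shufflesL p d) k = intMajGF (shufflesLS p d) k + intMajGF (shufflesLP p d) k := by
  rw [shufflesL_eq_union hp hd h.1,
    intMajGF_union (disjoint_shufflesLS_shufflesLP (h.letter_lt hp hd).ne)]

theorem disjoint_snocImage {A B : Finset (List ℤ)} (h : Disjoint A B) (v : ℤ) :
    Disjoint (snocImage A v) (snocImage B v) :=
  (Finset.disjoint_image fun _ _ hab => List.append_cancel_right hab).mpr h

theorem intMajGF_snocImage_shufflesL {p d : List ℤ} (h : Separated p d) (hp : p ≠ []) (hd : d ≠ [])
    (v k : ℤ) :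
    intMajGF (snocImage (shufflesL p d) v) k =
      (if v < letter d d.length then q ^ (p.length + d.length) * intMajGF (shufflesLS p d) (k - 1)
        else intMajGF (shufflesLS p d) k) +
      (if v < letter p p.length then q ^ (p.length + d.length) * intMajGF (shufflesLP p d) (k - 1)
        else intMajGF (shufflesLP p d) k) := by
  rw [shufflesL_eq_union hp hd h.1, snocImage_union,
    intMajGF_union (disjoint_snocImage (disjoint_shufflesLS_shufflesLP (h.letter_lt hp hd).ne) v),
    intMajGF_snocImage (shufflesLS_shape hd), intMajGF_snocImage (shufflesLP_shape hd)]

theorem des_snoc' {w : List ℤ} (h : w ≠ []) (v : ℤ) :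
    des (w ++ [v]) = des w + if v < letter w w.length then 1 else 0 := by
  obtain ⟨t, u, rfl⟩ := (List.eq_nil_or_concat' w).resolve_left h
  rw [letter_length_snoc, des_snoc]

theorem maj_snoc' {w : List ℤ} (h : w ≠ []) (v : ℤ) :
    maj (w ++ [v]) = maj w + if v < letter w w.length then w.length else 0 := by
  obtain ⟨t, u, rfl⟩ := (List.eq_nil_or_concat' w).resolve_left h
  rw [letter_length_snoc, maj_snoc, List.length_append, List.length_singleton]

theorem intMajGF_shufflesLS_eq_formLS_and_formLP {p d : List ℤ} (hd : d ≠ []) (hp : p ≠ [])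
    (h : Separated p d) (k : ℤ) :
    intMajGF (shufflesLS p d) k =
        formLS d.length (des d) p.length (des p) ((maj d : ℤ) + maj p) k ∧
      intMajGF (shufflesLP p d) k =
        formLP d.length (des d) p.length (des p) ((maj d : ℤ) + maj p) k := by
  induction d using List.reverseRecOn generalizing p k with
  | nil => exact absurd rfl hd
  | append_singleton d y ihd =>
    -- Proved for every `p`, because the inner induction on `p` needs it at the shorter words.
    have hLS : ∀ {p : List ℤ}, p ≠ [] → Separated p (d ++ [y]) → ∀ k : ℤ,
        intMajGF (shufflesLS p (d ++ [y])) k = formLS (d ++ [y]).length (des (d ++ [y])) p.length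
          (des p) ((maj (d ++ [y]) : ℤ) + maj p) k := by
      intro p hp h k
      rcases eq_or_ne d [] with rfl | hd'
      · rw [List.nil_append] at h ⊢
        rw [shufflesLS_singleton hp h.1, des_singleton]
        simp only [List.length_singleton, Nat.cast_one, Nat.cast_zero]
        rw [formLS_one (by omega)]
        rfl
      · have h' := h.of_snoc_right
        have hy : letter p p.length < y := h.2 y (by simp) _ (letter_length_mem hp)
        rw [shufflesLS_snoc hd' (h.notMem_right (by simp)),
          intMajGF_snocImage_shufflesL h' hp hd', if_neg hy.not_gt, des_snoc' hd', maj_snoc' hd',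
          (ihd hd' hp h' k).2]
        simp only [List.length_append, List.length_singleton, Nat.cast_add, Nat.cast_one]
        split_ifs
        · rw [(ihd hd' hp h' (k - 1)).1, Nat.cast_one, add_right_comm _ (d.length : ℤ),
            formLS_descent, ← Nat.cast_add d.length, zpow_natCast, add_comm p.length]
        · rw [(ihd hd' hp h' k).1, Nat.cast_zero, add_zero, add_zero, formLS_ascent,
            formLS_add_formLP]
    refine ⟨hLS hp h k, ?_⟩
    have hdy : d ++ [y] ≠ [] := by simp
    clear hd ihd
    -- From here δ is fixed and only `hLS` is needed, so the extended word is renamed `d`.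
    generalize d ++ [y] = d at *
    induction p using List.reverseRecOn generalizing k with
    | nil => exact absurd rfl hp
    | append_singleton p x ihp =>
      have hx : x < letter d d.length := h.2 _ (letter_length_mem hdy) x (by simp)
      rw [shufflesLP_snoc hdy fun hxd => h.notMem_right hxd (by simp)]
      rcases eq_or_ne p [] with rfl | hp'
      · rw [shufflesL_nil, List.nil_append, des_singleton, maj_singleton,
          intMajGF_snocImage (u := letter d d.length) (n := d.length), if_pos hx,
          intMajGF_singleton]
        · simp only [List.length_singleton, Nat.cast_one, Nat.cast_zero]
          rw [formLP_one (by omega), add_zero, mul_ite, mul_zero, ← pow_add, ← zpow_natCast,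
            Nat.cast_add]
          exact if_congr (by omega) rfl rfl
        · intro a ha
          rw [Finset.mem_singleton.mp ha]
          exact ⟨rfl, exists_snoc_of_letter hdy rfl⟩
      · have h' := h.of_snoc_left
        rw [intMajGF_snocImage_shufflesL h' hp' hdy, if_pos hx, des_snoc' hp', maj_snoc' hp',
          hLS hp' h']
        simp only [List.length_append, List.length_singleton, Nat.cast_add, Nat.cast_one]
        split_ifs
        · rw [ihp hp' _ h', Nat.cast_one, ← add_assoc, formLP_descent, ← formLS_add_formLP,
            mul_add, ← Nat.cast_add d.length, zpow_natCast, add_comm p.length]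
        · rw [ihp hp' _ h', Nat.cast_zero, add_zero, add_zero, formLP_ascent, ← Nat.cast_add d.length,
            zpow_natCast, add_comm p.length]

theorem formL_zero {m r M k : ℤ} (hr : 1 ≤ r) :
    formL m r 0 0 M k = if k = r then q ^ M else 0 := by
  rw [← formLS_ascent, formLS_zero hr]

theorem intMajGF_shufflesLS_eq {p d : List ℤ} (hd : d ≠ []) (h : Separated p d)
    (hpd : p ≠ [] ∨ 1 ≤ des d) (k : ℤ) :
    intMajGF (shufflesLS p d) k =
      formLS d.length (des d) p.length (des p) ((maj d : ℤ) + maj p) k := by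
  rcases eq_or_ne p [] with rfl | hp
  · have hr : 1 ≤ des d := hpd.resolve_left (· rfl)
    have e : des [] = 0 ∧ maj [] = 0 := by simp [des, maj, descentSet]
    rw [shufflesLS_nil, intMajGF_singleton, e.1, e.2]
    simp only [List.length_nil, Nat.cast_zero, add_zero]
    rw [formLS_zero (by omega), zpow_natCast]
    exact if_congr eq_comm rfl rfl
  · exact (intMajGF_shufflesLS_eq_formLS_and_formLP hd hp h k).1

theorem intMajGF_shufflesL_eq {p d : List ℤ} (hd : d ≠ []) (h : Separated p d)
    (hpd : p ≠ [] ∨ 1 ≤ des d) (k : ℤ) :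
    intMajGF (shufflesL p d) k =
      formL d.length (des d) p.length (des p) ((maj d : ℤ) + maj p) k := by
  rcases eq_or_ne p [] with rfl | hp
  · have hr : 1 ≤ des d := hpd.resolve_left (· rfl)
    have e : des [] = 0 ∧ maj [] = 0 := by simp [des, maj, descentSet]
    rw [shufflesL_nil, intMajGF_singleton, e.1, e.2]
    simp only [List.length_nil, Nat.cast_zero, add_zero]
    rw [formL_zero (by omega), zpow_natCast]
    exact if_congr eq_comm rfl rfl
  · obtain ⟨h1, h2⟩ := intMajGF_shufflesLS_eq_formLS_and_formLP hd hp h k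
    rw [intMajGF_shufflesL h hp hd, h1, h2, formLS_add_formLP]

/-! ### Shuffles that start with the first two letters of `δ` -/

theorem shufflesLL_cons {p d : List ℤ} {x : ℤ} (hx : x ∉ p) :
    shufflesLL p (x :: d) = (shufflesL p d).image (x :: ·) := by
  have h1 : ∀ w : List ℤ, letter (x :: w) 1 = x := fun w => rfl
  ext a
  simp only [shufflesLL, shufflesL, Finset.mem_filter, Finset.mem_image, mem_shuffles_iff,
    letter_cons_succ x d le_rfl, h1]
  constructor
  · rintro ⟨⟨hperm, hp, hs⟩, ha1, ha2⟩
    obtain ⟨z, w, rfl⟩ : ∃ z w, a = z :: w :=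
      List.exists_cons_of_ne_nil (by rintro rfl; simp at hs)
    obtain rfl : z = x := ha1
    refine ⟨w, ⟨⟨?_, ?_, List.cons_sublist_cons.mp hs⟩, ?_⟩, rfl⟩
    · exact (List.perm_cons z).mp (hperm.trans List.perm_middle)
    · cases hp with
      | cons _ hp => exact hp
      | cons_cons _ hp => simp at hx
    · rwa [letter_cons_succ _ _ le_rfl] at ha2
  · rintro ⟨w, ⟨⟨hperm, hp, hs⟩, ha⟩, rfl⟩
    refine ⟨⟨?_, hp.cons _, hs.cons_cons _⟩, rfl, ?_⟩
    · exact ((List.perm_cons x).mpr hperm).trans List.perm_middle.symm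
    · rwa [letter_cons_succ _ _ le_rfl]

/-- Each remaining word starts with the first letter of `d`, so prepending `x` moves its `k`
descents one place right. -/
theorem intMajGF_shufflesLL_cons {p d : List ℤ} {x : ℤ} (hx : x ∉ p)
    (hxd : x < letter d 1) (k : ℕ) :
    intMajGF (shufflesLL p (x :: d)) k = q ^ k * intMajGF (shufflesL p d) k := by
  rw [shufflesLL_cons hx, intMajGF, Finset.sum_image fun a _ b _ hab => (List.cons.inj hab).2,
    intMajGF, Finset.mul_sum]
  refine Finset.sum_congr rfl fun a ha => ?_
  have ha1 : x < letter a 1 := by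
    rw [shufflesL, Finset.mem_filter] at ha
    rwa [ha.2]
  rw [des_cons_of_ascent ha1, maj_cons_of_ascent ha1]
  split_ifs with hk
  · rw [Nat.cast_inj.mp hk, pow_add, mul_comm]
  · rw [mul_zero]

end ShuffleRefinement

open ShuffleRefinement in
theorem theorem3p4 (m n r s : ℕ) (δ π : List ℤ)
    (hδ : IsPerm m δ) (hπ : IsPerm n π) (hdisj : π.Disjoint δ)
    (hr : des δ = r) (hs : des π = s)
    (hm : 2 ≤ m) (h12 : letter δ 1 < letter δ 2)
    (hlarge : ∀ x ∈ δ, ∀ y ∈ π, y < x)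
    (hnr : 1 ≤ n ∨ 1 ≤ r) (d : ℕ) :
    majGF (shufflesL π δ) d =
        gauss ((m : ℤ) - r + s) ((d : ℤ) - r) * gauss ((n : ℤ) - s + r - 1) ((d : ℤ) - s - 1) *
          q ^ ((maj δ : ℤ) + maj π + ((d : ℤ) - s) * ((d : ℤ) - r)) ∧
    majGF (shufflesLS π δ) d =
        gauss ((m : ℤ) - r + s - 1) ((d : ℤ) - r) * gauss ((n : ℤ) - s + r - 1) ((d : ℤ) - s - 1) *
          q ^ ((maj δ : ℤ) + maj π + ((d : ℤ) - s) * ((d : ℤ) - r)) ∧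
    majGF (shufflesLL π δ) d =
        gauss ((m : ℤ) - r + s - 1) ((d : ℤ) - r) * gauss ((n : ℤ) - s + r - 1) ((d : ℤ) - s - 1) *
          q ^ ((maj δ : ℤ) + maj π + ((d : ℤ) - s + 1) * ((d : ℤ) - r)) := by
  obtain ⟨hδ, rfl⟩ := hδ
  obtain ⟨hπ, rfl⟩ := hπ
  subst hr hs
  have hsep : Separated π δ := ⟨List.Nodup.append hπ hδ hdisj, hlarge⟩
  have hne : δ ≠ [] := List.length_pos_iff.mp (by omega)
  have hnr' : π ≠ [] ∨ 1 ≤ des δ := hnr.imp_left fun h => List.length_pos_iff.mp h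
  simp only [majGF_eq_intMajGF]
  refine ⟨intMajGF_shufflesL_eq hne hsep hnr' d, intMajGF_shufflesLS_eq hne hsep hnr' d, ?_⟩
  obtain ⟨x, t, rfl⟩ := List.exists_cons_of_ne_nil hne
  have ht : t ≠ [] := by
    rintro rfl
    simp at hm
  have hx : x < letter t 1 := by rwa [letter_cons_succ _ _ le_rfl] at h12
  have hsep' : Separated π t :=
    ⟨hsep.1.sublist ((List.Sublist.refl π).append (List.sublist_cons_self x t)),
      fun z hz => hsep.2 z (List.mem_cons_of_mem x hz)⟩
  rw [des_cons_of_ascent hx] at hnr' ⊢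
  -- Here maj δ = maj t + r, and the factor q^d supplies d - r beyond that, turning (d - s)(d - r)
  -- into (d - s + 1)(d - r).
  rw [intMajGF_shufflesLL_cons (hsep.notMem_right List.mem_cons_self) hx,
    intMajGF_shufflesL_eq ht hsep' hnr', formL, maj_cons_of_ascent hx, mul_left_comm,
    ← zpow_natCast q d, ← zpow_add₀ q_ne_zero, List.length_cons]
  push_cast
  congr 1
  · congr 2; ring
  · congr 1; ring
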